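/- Let $\mathbb{F}_q$ be a finite field of characteristic $p$, let $n\ge 2$, and let $K=\overline{\mathbb{F}}_q$. Let $\mathcal S\subset\mathbb{P}^n(K)$ be a hypersurface $F=0$, where $F\in\mathbb{F}_q[X_0,\dots,X_n]$ is homogeneous and irreducible over $K$, and suppose that $\mathcal S$ is nondegenerate (contained in no hyperplane). The Gauss map $\Gamma=(\partial F/\partial X_0:\dots:\partial F/\partial X_n)$ sends a nonsingular point $P$ of $\mathcal S$ to its tangent hyperplane $T_P(\mathcal S)$, regarded as a point of the dual projective space; the strict dual $\mathcal S'$ is the Zariski closure of the image of $\Gamma$. Let $\Phi_q:(a_0:\dots:a_n)\mapsto(a_0^q:\dots:a_n^q)$ be the $\mathbb{F}_q$-Frobenius map. Suppose that $\mathcal S$ is $\mathbb{F}_q$-Frobenius nonclassical, i.e. $\Phi_q(P)\in T_P(\mathcal S)$ for every nonsingular point $P$ of $\mathcal S$, and that there are an integer $r>0$ with $p^r<q$ and functions $U_0,\dots,U_n\in K(\mathcal S)$, not all zero, such that $\Gamma=(U_0^{p^r}:\dots:U_n^{p^r})$ as rational maps on $\mathcal S$ and the rational map $(U_0:\dots:U_n)$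 is generically finite and separable onto the closure of its image; in other words, $K(\mathcal S)$ is a finite separable extension of its subfield generated over $K$ by the quotients $U_i/U_j$ ($U_j\ne 0$). Then: 1. $\Gamma$ is purely inseparable, i.e. $K(\mathcal S)$ is a purely inseparable extension of its subfield generated over $K$ by the quotients of the coordinates of $\Gamma$ (the function field of $\mathcal S'$). 2. $\mathcal S'$ is an irreducible hypersurface, and its strict dual $\mathcal S''$ is equal to $\mathcal S$. 3. If $\Gamma'$ denotes the Gauss map of $\mathcal S'$, then $\Gamma'\circ\Gamma=\Phi_q$ as rational maps on $\mathcal S$: the set of nonsingular points $P$ of $\mathcal S$ for which $\Gamma(P)$ is a nonsingular point of $\mathcal S'$ is Zariski dense in $\mathcal S$, and $\Gamma'(\Gamma(P))=\Phi_q(P)$ for each such $P$. -/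

import Mathlib

open MvPolynomial

noncomputable section

namespace FrobNonclassical

variable {n : ℕ} {K : Type*} [Field K]

/-! ### Hypersurfaces in projective space -/

/-- Projective `n`-space over `K`. The dual projective space is identified with it through the
coordinates: `(a₀ : … : aₙ)` stands for the hyperplane `a₀ X₀ + ⋯ + aₙ Xₙ = 0`. -/
abbrev ProjSpace (n : ℕ) (K : Type*) [Field K] : Type _ :=
  Projectivization K (Fin (n + 1) → K)

/-- The points of `ℙⁿ(K)` at which the form `F` vanishes. -/
def zeroLocus (F : MvPolynomial (Fin (n + 1)) K) : Set (ProjSpace n K) :=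
  {P | eval P.rep F = 0}

/-- The Zariski closure of a set of points of `ℙⁿ(K)`. -/
def zariskiClosure (Z : Set (ProjSpace n K)) : Set (ProjSpace n K) :=
  {P | ∀ (H : MvPolynomial (Fin (n + 1)) K) (d : ℕ), H.IsHomogeneous d →
    (∀ Q ∈ Z, eval Q.rep H = 0) → eval P.rep H = 0}

/-- `F` is an irreducible form with zero locus `S`. Over an algebraically closed field such an
`F` generates the ideal of `S`, so it is determined by `S` up to a nonzero constant. -/
structure IsEquationOf (F : MvPolynomial (Fin (n + 1)) K) (S : Set (ProjSpace n K)) : Prop where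
  homogeneous : ∃ d, F.IsHomogeneous d
  irreducible : Irreducible F
  zeroLocus_eq : zeroLocus F = S

/-- `S` is not contained in a hyperplane. -/
def IsNondegenerate (S : Set (ProjSpace n K)) : Prop :=
  ∀ a : Fin (n + 1) → K, a ≠ 0 → ∃ P ∈ S, ∑ i, a i * P.rep i ≠ 0

/-- The nonsingular points of the hypersurface `F = 0` (for irreducible `F`). -/
def regularLocus (F : MvPolynomial (Fin (n + 1)) K) : Set (ProjSpace n K) :=
  {P | P ∈ zeroLocus F ∧ (fun i => eval P.rep (pderiv i F)) ≠ 0}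

/-- The tangent hyperplane of the hypersurface `F = 0` at a nonsingular point `P`. -/
def tangentHyperplane (F : MvPolynomial (Fin (n + 1)) K) (P : ProjSpace n K) :
    Set (ProjSpace n K) :=
  {Q | ∑ i, eval P.rep (pderiv i F) * Q.rep i = 0}

/-- The Gauss map: a nonsingular point is sent to its tangent hyperplane, seen as a point of the
dual projective space. -/
def gaussMap (F : MvPolynomial (Fin (n + 1)) K) (P : ProjSpace n K) (hP : P ∈ regularLocus F) :
    ProjSpace n K :=
  Projectivization.mk K (fun i => eval P.rep (pderiv i F)) hP.2

/-- The strict dual of the hypersurface `F = 0`: the closure of the image of its Gauss map. -/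
def strictDual (F : MvPolynomial (Fin (n + 1)) K) : Set (ProjSpace n K) :=
  zariskiClosure {Q | ∃ (P : ProjSpace n K) (hP : P ∈ regularLocus F), gaussMap F P hP = Q}

/-- The map `(a₀ : … : aₙ) ↦ (a₀ ^ q : … : aₙ ^ q)`. -/
def frobeniusMap (q : ℕ) (P : ProjSpace n K) : ProjSpace n K :=
  Projectivization.mk K (fun i => P.rep i ^ q) (by
    intro h
    apply P.rep_nonzero
    funext i
    exact eq_zero_of_pow_eq_zero (congrFun h i))

/-- The Frobenius nonclassical locus: the nonsingular points `P` such that the image of `P` under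
the `q`-Frobenius map lies in the tangent hyperplane at `P`. -/
def frobeniusNonclassicalLocus (F : MvPolynomial (Fin (n + 1)) K) (q : ℕ) :
    Set (ProjSpace n K) :=
  {P | P ∈ regularLocus F ∧ frobeniusMap q P ∈ tangentHyperplane F P}

def IsFrobeniusNonclassical (F : MvPolynomial (Fin (n + 1)) K) (q : ℕ) : Prop :=
  frobeniusNonclassicalLocus F q = regularLocus F

/-! ### Function fields and rational maps -/

instance isPrime_span (F : MvPolynomial (Fin (n + 1)) K) [hF : Fact (Irreducible F)] :
    (Ideal.span {F}).IsPrime :=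
  (Ideal.span_singleton_prime hF.out.ne_zero).2 hF.out.prime

/-- The field of fractions of the homogeneous coordinate ring `K[X₀, …, Xₙ] / (F)`, that is, the
function field of the affine cone over the hypersurface `F = 0`. -/
abbrev ConeField (F : MvPolynomial (Fin (n + 1)) K) [Fact (Irreducible F)] : Type _ :=
  FractionRing (MvPolynomial (Fin (n + 1)) K ⧸ Ideal.span {F})

/-- The class of a polynomial in the function field of the cone. -/
def residue (F : MvPolynomial (Fin (n + 1)) K) [Fact (Irreducible F)]
    (H : MvPolynomial (Fin (n + 1)) K) : ConeField F :=
  algebraMap (MvPolynomial (Fin (n + 1)) K ⧸ Ideal.span {F}) (ConeField F)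
    (Ideal.Quotient.mk (Ideal.span {F}) H)

/-- The function field `K(S)` of the hypersurface `S : F = 0`: the subfield of the function field
of the cone that is generated over `K` by the quotients `xᵢ / xⱼ` of the projective
coordinates. -/
def functionField (F : MvPolynomial (Fin (n + 1)) K) [Fact (Irreducible F)] :
    IntermediateField K (ConeField F) :=
  IntermediateField.adjoin K {z | ∃ i j, z = residue F (X i) / residue F (X j)}

/-- Let `φ` be the tuple of projective coordinates of a rational map from `S : F = 0` to `ℙⁿ`.
This is the subfield `K(φᵢ / φⱼ)` of `K(S)`, the image of the function field of the closure of the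
image of the rational map under pull-back. -/
def fieldOfMap (F : MvPolynomial (Fin (n + 1)) K) [Fact (Irreducible F)]
    (φ : Fin (n + 1) → ConeField F) : IntermediateField K (functionField F) :=
  IntermediateField.adjoin K {z | ∃ i j, (z : ConeField F) = φ i / φ j}

/-- The rational map `φ` is generically finite (onto the closure of its image). -/
def IsGenericallyFinite (F : MvPolynomial (Fin (n + 1)) K) [Fact (Irreducible F)]
    (φ : Fin (n + 1) → ConeField F) : Prop :=
  FiniteDimensional (fieldOfMap F φ) (functionField F)

/-- The (generically finite) rational map `φ` is separable. -/
def IsSeparableMap (F : MvPolynomial (Fin (n + 1)) K) [Fact (Irreducible F)]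
    (φ : Fin (n + 1) → ConeField F) : Prop :=
  Algebra.IsSeparable (fieldOfMap F φ) (functionField F)

/-- The (generically finite) rational map `φ` is purely inseparable. -/
def IsPurelyInseparableMap (F : MvPolynomial (Fin (n + 1)) K) [Fact (Irreducible F)]
    (φ : Fin (n + 1) → ConeField F) : Prop :=
  IsPurelyInseparable (fieldOfMap F φ) (functionField F)

/-- The projective coordinates `F₀, …, Fₙ` of the Gauss map, `Fᵢ` being the class of
`∂F / ∂Xᵢ`. -/
def gaussCoord (F : MvPolynomial (Fin (n + 1)) K) [Fact (Irreducible F)]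
    (i : Fin (n + 1)) : ConeField F :=
  residue F (pderiv i F)

/-- The Gauss map is `(U₀ ^ (p ^ r) : … : Uₙ ^ (p ^ r))`, where `r > 0` and `(U₀ : … : Uₙ)` is a
generically finite separable rational map with coordinates in `K(S)`. -/
def PropertyA (F : MvPolynomial (Fin (n + 1)) K) [Fact (Irreducible F)] (p r : ℕ) : Prop :=
  0 < r ∧ ∃ U : Fin (n + 1) → functionField F, U ≠ 0 ∧
    (∀ i j, gaussCoord F i * (U j : ConeField F) ^ (p ^ r) =
      gaussCoord F j * (U i : ConeField F) ^ (p ^ r)) ∧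
    IsGenericallyFinite F (fun i => (U i : ConeField F)) ∧
    IsSeparableMap F (fun i => (U i : ConeField F))

end FrobNonclassical

end

noncomputable section

namespace FrobNonclassical

universe u
variable {n : ℕ} {K : Type u} [Field K]

/-! Let `x i` be the classes of the coordinates in the function field `L` of the cone and `F_i`
those of the partial derivatives of `F`. Frobenius nonclassicality says `∑ x_i ^ q F_i = 0` in `L`.
Rescale `U` to `v`, so that `v_j` is a coordinate `x_{j₀}`; then `v_i ^ p^r = c F_i`, and extracting
`p^r`-th roots gives `∑ x_i ^ s v_i = 0` with `s = q / p^r`. Since `p ∣ s`, every derivation `D` of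
`L` kills the `x_i ^ s`, whence `∑ x_i ^ s D v_i = 0`.

The field `L` has transcendence degree `n` and is separable algebraic over `K(v)`. So the relations
between the `v_i` are generated by one irreducible `H`, and the vectors `(D v_i)` fill the
orthogonal complement of the gradient of `H` at `v` (`exists_derivation_of_sum_eq_zero`). Hence this
gradient is proportional to `(x_i ^ s)`. Raising to the power `p^r` turns `H` into the equation `G`
of the dual and gives the key fact `gradient_dual_proportional`: the gradient of `G` at `(F_i)` is
proportional to `(x_i ^ q)`, that is, `Γ' ∘ Γ = Φ_q` generically.

The rest follows. The `q`-th powers of `x_i / x_k` lie in the field of `Γ`, so `Γ` is purely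
inseparable; and `Φ_q` maps the hypersurface onto itself because `F` is defined over `𝔽_q`, so the
bidual is the hypersurface. -/

/-! ### Polynomials in characteristic `p`. -/

theorem exists_expand_eq_of_pderiv_eq_zero {σ : Type*} (p : ℕ) [Fact p.Prime] [CharP K p]
    (F : MvPolynomial σ K) (h : ∀ i, pderiv i F = 0) : ∃ F' : MvPolynomial σ K, expand p F' = F := by
  classical
  have hdvd : ∀ m ∈ F.support, ∀ i, p ∣ m i := by
    intro m hm i
    by_cases hi : m i = 0
    · simp [hi]
    have h1 := congrArg (coeff (m - Finsupp.single i 1)) (h i)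
    have hle : Finsupp.single i 1 ≤ m := by
      rw [Finsupp.single_le_iff]; omega
    rw [coeff_pderiv, tsub_add_cancel_of_le hle, coeff_zero, mul_eq_zero] at h1
    have h2 := h1.resolve_left (mem_support_iff.1 hm)
    have h3 : ((m i : ℕ) : K) = 0 := by
      rw [← h2, Finsupp.tsub_apply, Finsupp.single_eq_same]
      rw [← Nat.cast_add_one, Nat.sub_add_cancel (by omega)]
    exact (CharP.cast_eq_zero_iff K p _).1 h3
  refine ⟨∑ m ∈ F.support, monomial (m.mapRange (· / p) (Nat.zero_div p)) (coeff m F), ?_⟩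
  conv_rhs => rw [← support_sum_monomial_coeff F]
  rw [map_sum]
  refine Finset.sum_congr rfl fun m hm => ?_
  rw [expand_monomial]
  have hm' : p • m.mapRange (· / p) (Nat.zero_div p) = m := by
    ext i
    simp [Nat.mul_div_cancel' (hdvd m hm i)]
  rw [hm']

/-- Otherwise `F` is a polynomial in the `X_i ^ p`, which over a perfect field is a `p`-th power. -/
theorem exists_pderiv_ne_zero {σ : Type*} (p : ℕ) [Fact p.Prime] [CharP K p] [PerfectRing K p]
    {F : MvPolynomial σ K} (hF : Irreducible F) : ∃ i, pderiv i F ≠ 0 := by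
  by_contra! h
  obtain ⟨F', rfl⟩ := exists_expand_eq_of_pderiv_eq_zero p F h
  have h2 : F'.expand p = (F'.map (frobeniusEquiv K p).symm.toRingHom) ^ p := by
    rw [← map_frobenius_expand p, map_expand, map_map]
    have : (frobenius K p).comp (frobeniusEquiv K p).symm.toRingHom = RingHom.id K := by
      ext x; exact frobenius_apply_frobeniusEquiv_symm K p x
    rw [← map_expand, map_expand, this, map_id]
  rw [h2] at hF
  exact not_irreducible_pow (Fact.out : p.Prime).one_lt.ne' hF

theorem aeval_mul_of_isHomogeneous {σ L : Type*} [CommRing L] [Algebra K L] {H : MvPolynomial σ K}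
    {e : ℕ} (hH : H.IsHomogeneous e) (c : L) (y : σ → L) :
    aeval (fun i => c * y i) H = c ^ e * aeval y H := by
  rw [aeval_def, aeval_def, eval₂_eq, eval₂_eq, Finset.mul_sum]
  refine Finset.sum_congr rfl fun m hm => ?_
  have : ∑ i ∈ m.support, m i = e := by
    have := hH.degree_eq_sum_deg_support hm
    exact this.symm
  rw [← this]
  simp only [mul_pow, Finset.prod_mul_distrib, Finset.prod_pow_eq_pow_sum]
  ring

theorem eval_mul_of_isHomogeneous {σ : Type*} {H : MvPolynomial σ K} {e : ℕ}
    (hH : H.IsHomogeneous e) (c : K) (y : σ → K) :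
    eval (fun i => c * y i) H = c ^ e * eval y H := by
  simpa [aeval_eq_eval] using aeval_mul_of_isHomogeneous hH c y

/-- Raising the value of a polynomial to a power of the characteristic. -/
theorem aeval_pow_char {σ L : Type*} [CommRing L] [Algebra K L] (p r : ℕ) [Fact p.Prime]
    [CharP K p] [CharP L p] (v : σ → L) (H : MvPolynomial σ K) :
    aeval (fun i => v i ^ p ^ r) (map (iterateFrobenius K p r) H) = aeval v H ^ p ^ r := by
  induction H using MvPolynomial.induction_on with
  | C a => simp [iterateFrobenius_def]
  | add f g hf hg => simp [hf, hg, add_pow_char_pow]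
  | mul_X f i hf => simp only [map_mul, hf, map_X, aeval_X, mul_pow]

/-! ### Transcendence degree and relations between `n + 1` elements. -/

/-- A transcendence basis of `C` lifts to one of `B`. A nonzero element of the kernel would be
algebraic over the lifted basis, so the kernel would contain a nonzero polynomial in it,
contradicting independence in `C`. -/
theorem injective_of_trdeg_le {B C : Type u} [CommRing B] [IsDomain B] [CommRing C] [IsDomain C]
    [Algebra K B] [Algebra K C] (f : B →ₐ[K] C) (hf : Function.Surjective f)
    (hfin : Algebra.trdeg K B < Cardinal.aleph0) (hle : Algebra.trdeg K B ≤ Algebra.trdeg K C) :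
    Function.Injective f := by
  obtain ⟨s, hs⟩ := exists_isTranscendenceBasis K C
  choose b hb using fun y : s => hf y
  have hbi : AlgebraicIndependent K b := by
    refine AlgebraicIndependent.of_comp f ?_
    have : (f ∘ b) = ((↑) : s → C) := funext hb
    rw [this]; exact hs.1
  have hcard : Algebra.trdeg K B ≤ Cardinal.mk s := by
    rwa [hs.cardinalMk_eq_trdeg]
  have hbt : IsTranscendenceBasis K b := hbi.isTranscendenceBasis_of_trdeg_le hfin hcard
  rw [injective_iff_map_eq_zero]
  intro z hz
  by_contra hz0
  have hAlg := hbt.isAlgebraic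
  have := Ideal.comap_ne_bot_of_algebraic_mem (R := Algebra.adjoin K (Set.range b))
    (I := RingHom.ker f) hz0 hz (hAlg.isAlgebraic z)
  apply this
  rw [eq_bot_iff]
  rintro ⟨w, hw⟩ hw0
  have hw0' : f w = 0 := hw0
  rw [Algebra.adjoin_range_eq_range_aeval] at hw
  obtain ⟨P, rfl⟩ := hw
  have h1 : aeval ((↑) : s → C) P = 0 := by
    rw [← hw0', ← funext hb]
    exact (comp_aeval_apply b f P).symm
  have hP : P = 0 := by
    exact (algebraicIndependent_iff.1 hs.1) P h1
  subst hP
  exact Subtype.ext (map_zero (aeval b))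

theorem trdeg_quotient_span_singleton {H : MvPolynomial (Fin (n + 1)) K} (hH : Irreducible H) :
    Algebra.trdeg K (MvPolynomial (Fin (n + 1)) K ⧸ Ideal.span {H}) = n := by
  have hprime : (Ideal.span {H}).IsPrime := (Ideal.span_singleton_prime hH.ne_zero).2 hH.prime
  have hK : Algebra.trdeg K (MvPolynomial (Fin (n + 1)) K) = (n + 1 : ℕ) := by
    rw [MvPolynomial.trdeg_of_isDomain]; simp
  apply le_antisymm
  · by_contra! hlt
    have h1 : ((n + 1 : ℕ) : Cardinal) ≤
        Algebra.trdeg K (MvPolynomial (Fin (n + 1)) K ⧸ Ideal.span {H}) := by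
      rw [Nat.cast_add_one, ← Cardinal.succ_natCast]
      exact Order.succ_le_of_lt hlt
    have hinj := injective_of_trdeg_le (Ideal.Quotient.mkₐ K (Ideal.span {H}))
      Ideal.Quotient.mk_surjective (by rw [hK]; exact Cardinal.natCast_lt_aleph0) (by rwa [hK])
    apply hH.ne_zero
    apply hinj
    rw [map_zero]
    exact Ideal.Quotient.eq_zero_iff_mem.2 (Ideal.mem_span_singleton_self H)
  -- Drop a variable `X j` that occurs in `H`: the other `n` stay independent modulo `H`, since a
  -- nonzero multiple of `H` has positive degree in `X j`.
  · have hv : ∃ j, degreeOf j H ≠ 0 := by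
      by_contra! h
      have h2 : H.totalDegree = 0 := by
        rw [totalDegree_eq_zero_iff]
        intro m hm j
        have := (degreeOf_le_iff (n := j) (f := H) (d := 0)).1 (h j).le m hm
        omega
      rw [totalDegree_eq_zero_iff_eq_C] at h2
      have hc : coeff 0 H ≠ 0 := by
        intro h0
        rw [h0, C_0] at h2
        exact hH.ne_zero h2
      apply hH.not_isUnit
      rw [h2]
      exact (isUnit_iff_ne_zero.2 hc).map C
    obtain ⟨j, hj⟩ := hv
    have hind : AlgebraicIndependent K
        (fun i => Ideal.Quotient.mkₐ K (Ideal.span {H}) (X (j.succAbove i))) := by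
      rw [algebraicIndependent_iff]
      intro P hP
      have h1 : Ideal.Quotient.mkₐ K (Ideal.span {H}) (rename j.succAbove P) = 0 := by
        rw [← hP, ← aeval_X_left_apply (rename j.succAbove P), aeval_rename, comp_aeval_apply]
        rfl
      have h2 : H ∣ rename j.succAbove P :=
        Ideal.mem_span_singleton.1 (Ideal.Quotient.eq_zero_iff_mem.1 h1)
      by_contra hP0
      have hP1 : rename j.succAbove P ≠ 0 := fun h0 =>
        hP0 (rename_injective _ Fin.succAbove_right_injective (by rw [h0, map_zero]))
      obtain ⟨Q, hQ⟩ := h2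
      have hQ0 : Q ≠ 0 := by rintro rfl; exact hP1 (by rw [hQ, mul_zero])
      have h3 : degreeOf j (rename j.succAbove P) = 0 := by
        classical
        by_contra hj0
        have hm := mem_vars_iff_degreeOf_ne_zero.2 hj0
        have := vars_rename _ _ hm
        obtain ⟨i, -, hi⟩ := Finset.mem_image.1 this
        exact Fin.succAbove_ne j i hi
      rw [hQ, degreeOf_mul_eq hH.ne_zero hQ0] at h3
      omega
    simpa using hind.lift_cardinalMk_le_trdeg

open IntermediateField.algebraAdjoinAdjoin in
theorem trdeg_adjoin_eq {L : Type u} [Field L] [Algebra K L] (S : Set L)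
    [Algebra.IsAlgebraic (IntermediateField.adjoin K S) L] :
    Algebra.trdeg K (Algebra.adjoin K S) = Algebra.trdeg K L := by
  have : Algebra.IsAlgebraic (Algebra.adjoin K S) L :=
    Algebra.IsAlgebraic.trans _ (IntermediateField.adjoin K S) _
  rw [← trdeg_add_eq K (Algebra.adjoin K S) (A := L), trdeg_eq_zero (A := L), add_zero]

/-- If `n + 1` elements `v` generate, up to algebraic elements, a field of transcendence degree `n`,
then an irreducible relation between them generates all relations. -/
theorem ker_aeval_eq_span {L : Type u} [Field L] [Algebra K L] (hL : Algebra.trdeg K L = n)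
    (v : Fin (n + 1) → L) [Algebra.IsAlgebraic (IntermediateField.adjoin K (Set.range v)) L]
    {H : MvPolynomial (Fin (n + 1)) K} (hH : Irreducible H) (hv : aeval v H = 0) :
    RingHom.ker (aeval v : MvPolynomial (Fin (n + 1)) K →ₐ[K] L) = Ideal.span {H} := by
  have hprime : (Ideal.span {H}).IsPrime := (Ideal.span_singleton_prime hH.ne_zero).2 hH.prime
  have hle : Ideal.span {H} ≤ RingHom.ker (aeval v : MvPolynomial (Fin (n + 1)) K →ₐ[K] L) := by
    rw [Ideal.span_singleton_le_iff_mem]; exact hv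
  refine le_antisymm ?_ hle
  let f : (MvPolynomial (Fin (n + 1)) K ⧸ Ideal.span {H}) →ₐ[K] L :=
    Ideal.Quotient.liftₐ _ (aeval v) hle
  have hf : f.range = Algebra.adjoin K (Set.range v) := by
    rw [Algebra.adjoin_range_eq_range_aeval]
    ext y
    constructor
    · rintro ⟨z, rfl⟩
      obtain ⟨P, rfl⟩ := Ideal.Quotient.mk_surjective z
      exact ⟨P, rfl⟩
    · rintro ⟨P, rfl⟩
      exact ⟨Ideal.Quotient.mk _ P, rfl⟩
  have ht : Algebra.trdeg K f.range = n := by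
    rw [hf, trdeg_adjoin_eq, hL]
  -- Both the quotient by `H` and `K[v]` are domains of transcendence degree `n`.
  have hinj := injective_of_trdeg_le f.rangeRestrict f.rangeRestrict_surjective
    (by rw [trdeg_quotient_span_singleton hH]; exact Cardinal.natCast_lt_aleph0)
    (by rw [trdeg_quotient_span_singleton hH, ht])
  intro P hP
  rw [← Ideal.Quotient.eq_zero_iff_mem]
  apply hinj
  rw [map_zero]
  exact Subtype.ext hP

/-- There are too many elements to be independent, and a nonzero prime ideal of a factorial ring
contains a prime element. -/
theorem exists_irreducible_ker_aeval_eq_span {L : Type u} [Field L] [Algebra K L]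
    (hL : Algebra.trdeg K L = n)
    (v : Fin (n + 1) → L) [Algebra.IsAlgebraic (IntermediateField.adjoin K (Set.range v)) L] :
    ∃ H : MvPolynomial (Fin (n + 1)) K, Irreducible H ∧
      RingHom.ker (aeval v : MvPolynomial (Fin (n + 1)) K →ₐ[K] L) = Ideal.span {H} := by
  have hne : RingHom.ker (aeval v : MvPolynomial (Fin (n + 1)) K →ₐ[K] L) ≠ ⊥ := by
    intro h
    have hinj : Function.Injective (aeval v : MvPolynomial (Fin (n + 1)) K →ₐ[K] L) :=
      (RingHom.injective_iff_ker_eq_bot _).2 h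
    have h1 := trdeg_le_of_injective _ hinj
    rw [MvPolynomial.trdeg_of_isDomain, hL] at h1
    rw [Cardinal.mk_fin, Cardinal.lift_natCast, Nat.cast_le] at h1
    omega
  obtain ⟨H, hHm, hH⟩ := Ideal.IsPrime.exists_mem_prime_of_ne_bot
    (RingHom.ker_isPrime (aeval v : MvPolynomial (Fin (n + 1)) K →ₐ[K] L)) hne
  exact ⟨H, hH.irreducible, ker_aeval_eq_span hL v hH.irreducible hHm⟩

/-! ### Derivations of separable extensions and gradients. -/

open IntermediateField.algebraAdjoinAdjoin TensorProduct in
/-- Derivations extend uniquely to a separable algebraic extension of the field of fractions. -/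
theorem exists_derivation_extension {L : Type u} [Field L] [Algebra K L] (S : Set L)
    [Algebra.IsSeparable (IntermediateField.adjoin K S) L]
    (d : Derivation K (Algebra.adjoin K S) L) :
    ∃ D : Derivation K L L, ∀ x : Algebra.adjoin K S, D (x : L) = d x := by
  have h1 : Algebra.FormallyEtale (Algebra.adjoin K S) (IntermediateField.adjoin K S) :=
    Algebra.FormallyEtale.of_isLocalization (nonZeroDivisors (Algebra.adjoin K S))
  have h2 : Algebra.FormallyEtale (IntermediateField.adjoin K S) L :=
    Algebra.FormallyEtale.of_isSeparable _ _
  have h3 : Algebra.FormallyEtale (Algebra.adjoin K S) L :=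
    Algebra.FormallyEtale.comp _ (IntermediateField.adjoin K S) _
  -- Localization and separable algebraic extension are both formally étale, so the differentials of
  -- `L` are the base change of those of the subalgebra.
  let e := KaehlerDifferential.tensorKaehlerEquivOfFormallyEtale K (Algebra.adjoin K S) L
  let g := (LinearMap.liftBaseChange L d.liftKaehlerDifferential) ∘ₗ e.symm.toLinearMap
  refine ⟨g.compDer (KaehlerDifferential.D K L), fun x => ?_⟩
  have h4 := KaehlerDifferential.tensorKaehlerEquivOfFormallyEtale_symm_D_algebraMap K
    (Algebra.adjoin K S) L x
  change LinearMap.liftBaseChange L d.liftKaehlerDifferential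
    (e.symm (KaehlerDifferential.D K L (algebraMap _ L x))) = _
  rw [h4, LinearMap.liftBaseChange_tmul, one_smul, Derivation.liftKaehlerDifferential_comp_D]

/-- A vector that is orthogonal to the gradient of the generator of the ideal of relations between
the `v i` is the vector of the values of a derivation. -/
theorem exists_derivation_of_sum_eq_zero {L : Type u} [Field L] [Algebra K L]
    (v : Fin (n + 1) → L) [Algebra.IsSeparable (IntermediateField.adjoin K (Set.range v)) L]
    {H : MvPolynomial (Fin (n + 1)) K}
    (hker : RingHom.ker (aeval v : MvPolynomial (Fin (n + 1)) K →ₐ[K] L) = Ideal.span {H})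
    (w : Fin (n + 1) → L) (hw : ∑ i, aeval v (pderiv i H) * w i = 0) :
    ∃ D : Derivation K L L, ∀ i, D (v i) = w i := by
  let δ : MvPolynomial (Fin (n + 1)) K →ₗ[K] L :=
    ∑ i, LinearMap.mulRight K (w i) ∘ₗ (aeval v).toLinearMap ∘ₗ (pderiv i).toLinearMap
  have hδ : ∀ P, δ P = ∑ i, aeval v (pderiv i P) * w i := fun P => by
    simp [δ, LinearMap.sum_apply]
  have hmul : ∀ P Q, δ (P * Q) = aeval v P * δ Q + aeval v Q * δ P := fun P Q => by
    simp only [hδ, Derivation.leibniz, map_add, smul_eq_mul, map_mul, Finset.mul_sum,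
      add_mul, Finset.sum_add_distrib, mul_assoc]
  have hH0 : aeval v H = 0 := by
    have : H ∈ RingHom.ker (aeval v : MvPolynomial (Fin (n + 1)) K →ₐ[K] L) :=
      hker ▸ Ideal.mem_span_singleton_self H
    exact this
  have hzero : ∀ P, aeval v P = 0 → δ P = 0 := by
    intro P hP
    have : P ∈ Ideal.span {H} := hker ▸ hP
    obtain ⟨Q, rfl⟩ := Ideal.mem_span_singleton.1 this
    rw [hmul, hH0, hδ H, hw, mul_zero, zero_mul, add_zero]
  have hwd : ∀ P Q, aeval v P = aeval v Q → δ P = δ Q := fun P Q h => by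
    rw [← sub_eq_zero, ← map_sub]
    exact hzero _ (by rw [map_sub, h, sub_self])
  have hsurj : ∀ y : Algebra.adjoin K (Set.range v), ∃ P : MvPolynomial (Fin (n + 1)) K,
      aeval v P = (y : L) := by
    rintro ⟨y, hy⟩
    rw [Algebra.adjoin_range_eq_range_aeval] at hy
    exact hy
  -- The derivation is computed on an arbitrary polynomial representative; by `hwd` the choice is
  -- immaterial.
  choose s hs using hsurj
  let d : Derivation K (Algebra.adjoin K (Set.range v)) L := Derivation.mk'
    { toFun := fun y => δ (s y)
      map_add' := fun y z => by
        rw [← map_add]; exact hwd _ _ (by simp [hs])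
      map_smul' := fun c y => by
        rw [RingHom.id_apply, ← map_smul]; exact hwd _ _ (by simp [hs]) }
    (fun y z => by
      change δ (s (y * z)) = _ • δ (s z) + _ • δ (s y)
      rw [hwd (s (y * z)) (s y * s z) (by simp [hs]), hmul, hs, hs]
      rfl)
  obtain ⟨D, hD⟩ := exists_derivation_extension (Set.range v) d
  refine ⟨D, fun i => ?_⟩
  have h1 := hD ⟨v i, Algebra.subset_adjoin ⟨i, rfl⟩⟩
  rw [h1]
  change δ (s _) = _
  rw [hwd _ (X i) (by simp [hs]), hδ]
  classical
  simp [pderiv_X, Pi.single_apply]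

/-- The linear form that vanishes on all `(D v₀, …, D vₙ)` is proportional to the gradient. -/
theorem gradient_proportional {L : Type u} [Field L] [Algebra K L]
    (v : Fin (n + 1) → L) [Algebra.IsSeparable (IntermediateField.adjoin K (Set.range v)) L]
    {H : MvPolynomial (Fin (n + 1)) K}
    (hker : RingHom.ker (aeval v : MvPolynomial (Fin (n + 1)) K →ₐ[K] L) = Ideal.span {H})
    (b : Fin (n + 1) → L) (hb : ∃ i, b i ≠ 0)
    (hD : ∀ D : Derivation K L L, ∑ i, b i * D (v i) = 0) :
    (∀ i j, aeval v (pderiv i H) * b j = aeval v (pderiv j H) * b i) ∧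
      ∃ i, aeval v (pderiv i H) ≠ 0 := by
  have key : ∀ w : Fin (n + 1) → L, ∑ i, aeval v (pderiv i H) * w i = 0 → ∑ i, b i * w i = 0 := by
    intro w hw
    obtain ⟨D, hDw⟩ := exists_derivation_of_sum_eq_zero v hker w hw
    simpa [hDw] using hD D
  constructor
  · intro i j
    -- The test vector is the obvious vector orthogonal to the gradient, supported on two indices.
    have h := key (Pi.single j (aeval v (pderiv i H)) - Pi.single i (aeval v (pderiv j H))) (by
      simp [mul_sub, Pi.single_apply, mul_comm])
    simp only [Pi.sub_apply, mul_sub, Finset.sum_sub_distrib, Pi.single_apply, mul_ite, mul_zero,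
      Finset.sum_ite_eq', Finset.mem_univ, if_true] at h
    linear_combination h
  · by_contra! h0
    obtain ⟨i, hi⟩ := hb
    have h := key (Pi.single i 1) (by simp [h0])
    simp [Pi.single_apply] at h
    exact hi h

/-! ### The function field of the cone, the Nullstellensatz, and nondegeneracy. -/

section Cone

variable (F : MvPolynomial (Fin (n + 1)) K) [Fact (Irreducible F)]

/-- The class of the coordinate `Xᵢ` in the function field of the cone. -/
def coord (i : Fin (n + 1)) : ConeField F := residue F (X i)

/-- `residue` as a homomorphism of algebras. -/
def residueHom : MvPolynomial (Fin (n + 1)) K →ₐ[K] ConeField F :=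
  (IsScalarTower.toAlgHom K (MvPolynomial (Fin (n + 1)) K ⧸ Ideal.span {F}) (ConeField F)).comp
    (Ideal.Quotient.mkₐ K (Ideal.span {F}))

theorem residue_eq_aeval (H : MvPolynomial (Fin (n + 1)) K) :
    residue F H = aeval (coord F) H := by
  have : residueHom F = aeval (coord F) := by
    ext i
    rw [aeval_X]
    rfl
  rw [← this]
  rfl

theorem residue_eq_zero_iff {H : MvPolynomial (Fin (n + 1)) K} : residue F H = 0 ↔ F ∣ H := by
  rw [residue, IsFractionRing.to_map_eq_zero_iff, Ideal.Quotient.eq_zero_iff_mem,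
    Ideal.mem_span_singleton]

theorem aeval_coord_eq_zero_iff {H : MvPolynomial (Fin (n + 1)) K} :
    aeval (coord F) H = 0 ↔ F ∣ H := by
  rw [← residue_eq_aeval, residue_eq_zero_iff]

theorem trdeg_coneField : Algebra.trdeg K (ConeField F) = n := by
  rw [← trdeg_quotient_span_singleton (Fact.out : Irreducible F),
    ← trdeg_add_eq K (MvPolynomial (Fin (n + 1)) K ⧸ Ideal.span {F}) (A := ConeField F)]
  have : Algebra.IsAlgebraic (MvPolynomial (Fin (n + 1)) K ⧸ Ideal.span {F}) (ConeField F) :=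
    IsLocalization.isAlgebraic _ (nonZeroDivisors _)
  rw [trdeg_eq_zero (A := ConeField F), add_zero]

/-- A subfield that contains the coordinates is the whole function field of the cone. -/
theorem mem_of_coord_mem (T : IntermediateField K (ConeField F)) (hT : ∀ i, coord F i ∈ T)
    (z : ConeField F) : z ∈ T := by
  have hA : ∀ H, residue F H ∈ T := by
    intro H
    rw [residue_eq_aeval]
    have : aeval (coord F) H = ((aeval (fun i => (⟨coord F i, hT i⟩ : T)) H : T) : ConeField F) := by
      rw [← IntermediateField.coe_val, comp_aeval_apply]
      rfl
    rw [this]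
    exact SetLike.coe_mem _
  obtain ⟨a, b, -, rfl⟩ := IsFractionRing.div_surjective
    (A := MvPolynomial (Fin (n + 1)) K ⧸ Ideal.span {F}) z
  obtain ⟨a, rfl⟩ := Ideal.Quotient.mk_surjective a
  obtain ⟨b, rfl⟩ := Ideal.Quotient.mk_surjective b
  exact T.div_mem (hA a) (hA b)

theorem coord_div_mem (i j : Fin (n + 1)) : coord F i / coord F j ∈ functionField F :=
  IntermediateField.subset_adjoin _ _ ⟨i, j, rfl⟩

/-- A form is a power of a coordinate times an element of the function field. -/
theorem exists_aeval_coord_eq {j : Fin (n + 1)} (hj : coord F j ≠ 0)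
    {H : MvPolynomial (Fin (n + 1)) K} {e : ℕ} (hH : H.IsHomogeneous e) :
    ∃ m : functionField F, aeval (coord F) H = coord F j ^ e * m := by
  refine ⟨aeval (fun i => (⟨coord F i / coord F j, coord_div_mem F i j⟩ : functionField F)) H, ?_⟩
  have h1 : coord F = fun i => coord F j * (coord F i / coord F j) := by
    ext i; field_simp
  conv_lhs => rw [h1]
  rw [aeval_mul_of_isHomogeneous hH, ← IntermediateField.coe_val, comp_aeval_apply]
  rfl

variable {F} in
theorem dvd_of_forall_eval [IsAlgClosed K] {H : MvPolynomial (Fin (n + 1)) K}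
    (h : ∀ a, eval a F = 0 → eval a H = 0) : F ∣ H := by
  rw [← Ideal.mem_span_singleton,
    ← IsPrime.vanishingIdeal_zeroLocus (K := K) (Ideal.span {F}), mem_vanishingIdeal_iff]
  intro a ha
  rw [mem_zeroLocus_iff] at ha
  have := ha F (Ideal.mem_span_singleton_self F)
  simpa [aeval_eq_eval] using h a (by simpa [aeval_eq_eval] using this)

-- Projective points do not see the origin; the factor `X j` takes care of it and is not divisible
-- by `F`.
variable {F} in
theorem dvd_of_forall_ne_zero_eval [IsAlgClosed K] {j : Fin (n + 1)} (hj : coord F j ≠ 0)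
    {H : MvPolynomial (Fin (n + 1)) K}
    (h : ∀ a, a ≠ 0 → eval a F = 0 → eval a H = 0) : F ∣ H := by
  have h1 : F ∣ X j * H := dvd_of_forall_eval fun a ha => by
    by_cases ha0 : a = 0
    · simp [ha0]
    · simp [h a ha0 ha]
  refine ((Fact.out : Irreducible F).prime.dvd_or_dvd h1).resolve_left fun h2 => hj ?_
  exact (residue_eq_zero_iff F).2 h2

omit [Fact (Irreducible F)] in
variable {F} in
theorem not_dvd_linear (h : IsNondegenerate (zeroLocus F)) {a : Fin (n + 1) → K} (ha : a ≠ 0) :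
    ¬ F ∣ ∑ i, C (a i) * X i := by
  rintro ⟨Q, hQ⟩
  obtain ⟨P, hP, hne⟩ := h a ha
  apply hne
  have := congrArg (eval P.rep) hQ
  rw [map_mul, show eval P.rep F = 0 from hP, zero_mul] at this
  simpa using this

variable {F} in
theorem coord_ne_zero (h : IsNondegenerate (zeroLocus F)) (i : Fin (n + 1)) : coord F i ≠ 0 := by
  intro h0
  apply not_dvd_linear h (a := Pi.single i 1) (by simp)
  have : ∑ j, C (Pi.single (M := fun _ => K) i 1 j) * X j = (X i : MvPolynomial (Fin (n + 1)) K) := by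
    simp [Pi.single_apply, apply_ite C]
  rw [this]
  exact (residue_eq_zero_iff F).1 h0

-- A form of degree 0 is zero or a unit, and by Euler's formula one of degree 1 defines a
-- hyperplane.
variable {F} in
theorem two_le_of_isHomogeneous (h : IsNondegenerate (zeroLocus F)) {d : ℕ}
    (hd : F.IsHomogeneous d) : 2 ≤ d := by
  have hirr : Irreducible F := Fact.out
  by_contra! hlt
  interval_cases d
  · rw [← totalDegree_zero_iff_isHomogeneous, totalDegree_eq_zero_iff_eq_C] at hd
    apply hirr.not_isUnit
    have hc : coeff 0 F ≠ 0 := by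
      intro h0
      rw [h0, C_0] at hd
      exact hirr.ne_zero hd
    rw [hd]
    exact (isUnit_iff_ne_zero.2 hc).map C
  · have hF : F = ∑ i, C (coeff (Finsupp.single i 1) F) * X i := by
      have h1 := hd.sum_X_mul_pderiv
      rw [one_smul] at h1
      conv_lhs => rw [← h1]
      refine Finset.sum_congr rfl fun i _ => ?_
      have h2 : (pderiv i F).IsHomogeneous 0 := hd.pderiv
      rw [← totalDegree_zero_iff_isHomogeneous, totalDegree_eq_zero_iff_eq_C] at h2
      rw [h2, coeff_pderiv, mul_comm]
      simp
    have ha : (fun i => coeff (Finsupp.single i 1) F) ≠ 0 := by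
      intro h0
      apply hirr.ne_zero
      rw [hF]
      simp [fun i => congrFun h0 i]
    exact not_dvd_linear h ha (by rw [← hF])

end Cone

/-! ### Transfer of separability and algebraicity from `K(S)` to the function field of the cone. -/

section Tower

variable {L : Type*} [Field L] [Algebra K L] {M T : IntermediateField K L}
  {N : IntermediateField K M}

/-- The inclusion of a subfield `N` of a subfield `M` into a subfield `T`. -/
def inclusionOfLe (h : ∀ z : M, z ∈ N → (z : L) ∈ T) : N →+* T where
  toFun z := ⟨z.1.1, h z.1 z.2⟩
  map_one' := rfl
  map_mul' _ _ := rfl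
  map_zero' := rfl
  map_add' _ _ := rfl

theorem aeval_map_inclusionOfLe (h : ∀ z : M, z ∈ N → (z : L) ∈ T) (z : M) (P : Polynomial N) :
    Polynomial.aeval (z : L) (P.map (inclusionOfLe h)) = ((Polynomial.aeval z P : M) : L) := by
  have h1 : (algebraMap T L).comp (inclusionOfLe h) =
      (algebraMap M L).comp (algebraMap N M) := RingHom.ext fun _ => rfl
  rw [Polynomial.aeval_def, Polynomial.eval₂_map, Polynomial.aeval_def, h1]
  exact (Polynomial.hom_eval₂ P (algebraMap N M) (algebraMap M L) z).symm

theorem isSeparable_of_le (h : ∀ z : M, z ∈ N → (z : L) ∈ T) (z : M) (hz : IsSeparable N z) :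
    IsSeparable T (z : L) := by
  have h1 : ((minpoly N z).map (inclusionOfLe h)).Separable := Polynomial.Separable.map hz
  refine h1.of_dvd (minpoly.dvd _ _ ?_)
  rw [aeval_map_inclusionOfLe, minpoly.aeval]
  rfl

theorem isAlgebraic_of_le (h : ∀ z : M, z ∈ N → (z : L) ∈ T) (z : M) (hz : IsAlgebraic N z) :
    IsAlgebraic T (z : L) := by
  obtain ⟨P, hP, hPz⟩ := hz
  refine ⟨P.map (inclusionOfLe h), ?_, ?_⟩
  · rwa [Ne, Polynomial.map_eq_zero]
  · rw [aeval_map_inclusionOfLe, hPz]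
    rfl

end Tower

section Fields

variable (F : MvPolynomial (Fin (n + 1)) K) [Fact (Irreducible F)]

theorem div_mem_of_mem_fieldOfMap {φ : Fin (n + 1) → ConeField F}
    {T : IntermediateField K (ConeField F)} (hT : ∀ i j, φ i / φ j ∈ T) (z : functionField F)
    (hz : z ∈ fieldOfMap F φ) : (z : ConeField F) ∈ T := by
  have : fieldOfMap F φ ≤ T.comap (functionField F).val := by
    rw [fieldOfMap, IntermediateField.adjoin_le_iff]
    rintro y ⟨i, j, hy⟩
    change (y : ConeField F) ∈ T
    rw [hy]
    exact hT i j
  exact this hz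

theorem isSeparable_of_fieldOfMap {φ : Fin (n + 1) → ConeField F}
    {T : IntermediateField K (ConeField F)} (hT : ∀ i j, φ i / φ j ∈ T) (z : functionField F)
    (hz : IsSeparable (fieldOfMap F φ) z) : IsSeparable T (z : ConeField F) :=
  isSeparable_of_le (div_mem_of_mem_fieldOfMap F hT) z hz

theorem isAlgebraic_of_fieldOfMap {φ : Fin (n + 1) → ConeField F}
    {T : IntermediateField K (ConeField F)} (hT : ∀ i j, φ i / φ j ∈ T) (z : functionField F)
    (hz : IsAlgebraic (fieldOfMap F φ) z) : IsAlgebraic T (z : ConeField F) :=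
  isAlgebraic_of_le (div_mem_of_mem_fieldOfMap F hT) z hz

/-- The scaling puts `x_{j₀}` itself (the entry at `j`) among the generators. So the field contains
all `φ i / φ k`, over which `K(S)` is separable, and `K(S)` together with `x_{j₀}` generates
everything. -/
theorem isSeparable_adjoin_range {φ : Fin (n + 1) → ConeField F} (hφ : IsSeparableMap F φ)
    {j₀ j : Fin (n + 1)} (hj₀ : coord F j₀ ≠ 0) (hj : φ j ≠ 0) :
    Algebra.IsSeparable
      (IntermediateField.adjoin K (Set.range fun i => coord F j₀ / φ j * φ i)) (ConeField F) := by
  set E := IntermediateField.adjoin K (Set.range fun i => coord F j₀ / φ j * φ i) with hE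
  have hv : ∀ i, coord F j₀ / φ j * φ i ∈ E := fun i =>
    IntermediateField.subset_adjoin _ _ ⟨i, rfl⟩
  have h0 : coord F j₀ ∈ E := by
    have := hv j
    rwa [div_mul_cancel₀ _ hj] at this
  have hT : ∀ i k, φ i / φ k ∈ E := by
    intro i k
    have := E.div_mem (hv i) (hv k)
    rwa [mul_div_mul_left _ _ (div_ne_zero hj₀ hj)] at this
  have hsep : ∀ z : functionField F, IsSeparable E (z : ConeField F) := fun z =>
    isSeparable_of_fieldOfMap F hT z (hφ.isSeparable' z)
  rw [← separableClosure.eq_top_iff, eq_top_iff]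
  intro z _
  refine mem_of_coord_mem F ((separableClosure E (ConeField F)).restrictScalars K) (fun i => ?_) z
  have h1 : coord F i = coord F j₀ * (coord F i / coord F j₀) := by field_simp
  rw [h1]
  refine mul_mem ?_ ?_
  · exact IntermediateField.algebraMap_mem _ (⟨_, h0⟩ : E)
  · exact hsep ⟨_, coord_div_mem F i j₀⟩

end Fields

/-! ### Homogeneity of the ideal of relations. -/

section Homogeneous

attribute [local instance] MvPolynomial.gradedAlgebra in
theorem dvd_homogeneousComponent {F Q : MvPolynomial (Fin (n + 1)) K} {d : ℕ}
    (hF : F.IsHomogeneous d) (h : F ∣ Q) (m : ℕ) : F ∣ homogeneousComponent m Q := by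
  have hI : (Ideal.span {F}).IsHomogeneous (homogeneousSubmodule (Fin (n + 1)) K) :=
    Ideal.homogeneous_span _ _ (by
      rintro x rfl
      exact ⟨d, hF⟩)
  exact Ideal.mem_span_singleton.1
    (homogeneousComponent_mem_of_mem hI (Ideal.mem_span_singleton.2 h) m)

/-- The relations between forms of the same positive degree form a homogeneous ideal. -/
theorem dvd_aeval_homogeneousComponent {F : MvPolynomial (Fin (n + 1)) K} {d : ℕ}
    (hF : F.IsHomogeneous d) {g : Fin (n + 1) → MvPolynomial (Fin (n + 1)) K} {b : ℕ} (hb : 0 < b)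
    (hg : ∀ i, (g i).IsHomogeneous b) {H : MvPolynomial (Fin (n + 1)) K} (h : F ∣ aeval g H)
    (e : ℕ) : F ∣ aeval g (homogeneousComponent e H) := by
  have h1 := dvd_homogeneousComponent hF h (b * e)
  have h2 : ∀ m, homogeneousComponent (b * e) (aeval g (homogeneousComponent m H)) =
      if m = e then aeval g (homogeneousComponent m H) else 0 := by
    intro m
    have h3 : aeval g (homogeneousComponent m H) ∈ homogeneousSubmodule (Fin (n + 1)) K (b * m) :=
      (homogeneousComponent_isHomogeneous m H).aeval g hg
    rw [homogeneousComponent_of_mem h3]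
    congr 1
    simp [hb.ne', eq_comm]
  by_cases he : e ≤ H.totalDegree
  · have h4 : homogeneousComponent (b * e) (aeval g H) = aeval g (homogeneousComponent e H) := by
      conv_lhs => rw [← sum_homogeneousComponent H]
      simp only [map_sum, h2]
      rw [Finset.sum_ite_eq', if_pos (Finset.mem_range.2 (by omega))]
    rwa [h4] at h1
  · rw [homogeneousComponent_eq_zero _ _ (by omega), map_zero]
    exact dvd_zero _

/-- A component of degree below that of `G` can be a multiple of `G` only if it is zero. -/
theorem isHomogeneous_of_dvd_homogeneousComponent {G : MvPolynomial (Fin (n + 1)) K}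
    (h : ∀ e, G ∣ homogeneousComponent e G) : G.IsHomogeneous G.totalDegree := by
  have h1 : ∀ e ∈ Finset.range (G.totalDegree + 1), e ≠ G.totalDegree →
      homogeneousComponent e G = 0 := by
    intro e he hne
    by_contra h0
    have h2 := totalDegree_le_of_dvd_of_isDomain (h e) h0
    rw [(homogeneousComponent_isHomogeneous e G).totalDegree h0] at h2
    rw [Finset.mem_range] at he
    omega
  have h2 := sum_homogeneousComponent G
  rw [Finset.sum_eq_single_of_mem G.totalDegree (Finset.self_mem_range_succ _) h1] at h2
  have h3 := homogeneousComponent_isHomogeneous G.totalDegree G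
  rwa [h2] at h3

end Homogeneous

/-! ### The coordinates of the Gauss map and the gradient of the dual. -/

section Gauss

variable (F : MvPolynomial (Fin (n + 1)) K) [Fact (Irreducible F)]

theorem gaussCoord_eq (i : Fin (n + 1)) : gaussCoord F i = aeval (coord F) (pderiv i F) :=
  residue_eq_aeval F _

theorem aeval_gaussCoord (H : MvPolynomial (Fin (n + 1)) K) :
    aeval (gaussCoord F) H = aeval (coord F) (aeval (fun i => pderiv i F) H) := by
  rw [comp_aeval_apply]
  congr 2
  ext i
  exact gaussCoord_eq F i

theorem exists_gaussCoord_ne_zero (p : ℕ) [Fact p.Prime] [CharP K p] [PerfectRing K p] {d : ℕ}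
    (hd : F.IsHomogeneous d) (hd2 : 2 ≤ d) : ∃ i, gaussCoord F i ≠ 0 := by
  have hirr : Irreducible F := Fact.out
  obtain ⟨i, hi⟩ := exists_pderiv_ne_zero p hirr
  refine ⟨i, fun h => ?_⟩
  have h1 := totalDegree_le_of_dvd_of_isDomain ((residue_eq_zero_iff F).1 h) hi
  rw [hd.totalDegree hirr.ne_zero, hd.pderiv.totalDegree hi] at h1
  omega

variable {F}

/-- The `N`-th powers of the `U i / U k` are quotients of Gauss coordinates, so `K(S)` is algebraic
over the field these generate. This misses only the scaling of the cone, recovered from a Gauss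
coordinate, which has degree `d - 1 > 0`. -/
theorem isAlgebraic_adjoin_gaussCoord {U : Fin (n + 1) → functionField F} {N d : ℕ} (hN : N ≠ 0)
    (hU : ∀ i j, gaussCoord F i * (U j : ConeField F) ^ N = gaussCoord F j * (U i : ConeField F) ^ N)
    (hfin : IsGenericallyFinite F (fun i => (U i : ConeField F)))
    (hd : F.IsHomogeneous d) (hd2 : 2 ≤ d) {j j₀ : Fin (n + 1)} (hj : gaussCoord F j ≠ 0)
    (hj₀ : coord F j₀ ≠ 0) :
    Algebra.IsAlgebraic (IntermediateField.adjoin K (Set.range (gaussCoord F))) (ConeField F) := by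
  set E := IntermediateField.adjoin K (Set.range (gaussCoord F)) with hE
  have hmem : ∀ i, gaussCoord F i ∈ E := fun i => IntermediateField.subset_adjoin _ _ ⟨i, rfl⟩
  let T := (algebraicClosure E (ConeField F)).restrictScalars K
  have hTmem : ∀ z, z ∈ T ↔ IsAlgebraic E z := fun z => mem_algebraicClosure_iff
  have hpow : ∀ (z : ConeField F) (m : ℕ), m ≠ 0 → z ^ m ∈ T → z ∈ T := fun z m hm hz =>
    (hTmem z).2 (((hTmem _).1 hz).of_pow (Nat.pos_of_ne_zero hm))
  have hET : ∀ z ∈ E, z ∈ T := fun z hz =>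
    (algebraicClosure E (ConeField F)).algebraMap_mem (⟨z, hz⟩ : E)
  have hT : ∀ i k, (U i : ConeField F) / (U k : ConeField F) ∈ T := by
    intro i k
    by_cases hk : (U k : ConeField F) = 0
    · rw [hk, div_zero]; exact T.zero_mem
    have hFk : gaussCoord F k ≠ 0 := by
      intro h0
      have h1 := hU k j
      rw [h0, zero_mul] at h1
      exact mul_ne_zero hj (pow_ne_zero _ hk) h1.symm
    refine hpow _ N hN (hET _ ?_)
    have h2 : ((U i : ConeField F) / (U k : ConeField F)) ^ N = gaussCoord F i / gaussCoord F k := by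
      rw [div_pow, div_eq_div_iff (pow_ne_zero _ hk) hFk]
      linear_combination -hU i k
    rw [h2]
    exact E.div_mem (hmem i) (hmem k)
  have hM : ∀ z : functionField F, (z : ConeField F) ∈ T := by
    intro z
    have h1 : IsAlgebraic (fieldOfMap F fun i => (U i : ConeField F)) z := by
      have h2 : FiniteDimensional (fieldOfMap F fun i => (U i : ConeField F)) (functionField F) :=
        hfin
      exact IsAlgebraic.of_finite _ z
    have h3 : IsAlgebraic (algebraicClosure E (ConeField F)) (z : ConeField F) :=
      isAlgebraic_of_fieldOfMap F hT z h1
    exact (hTmem _).2 (h3.restrictScalars E)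
  have hx : coord F j₀ ∈ T := by
    refine hpow _ (d - 1) (by omega) ?_
    obtain ⟨m, hm⟩ := exists_aeval_coord_eq F hj₀ (hd.pderiv (i := j))
    rw [← gaussCoord_eq] at hm
    have hm0 : (m : ConeField F) ≠ 0 := by
      intro h0
      rw [h0, mul_zero] at hm
      exact hj hm
    have h1 : coord F j₀ ^ (d - 1) = gaussCoord F j / m := by
      rw [hm]; field_simp
    rw [h1]
    exact T.div_mem (hET _ (hmem j)) (hM m)
  refine ⟨fun z => (hTmem z).1 (mem_of_coord_mem F T (fun i => ?_) z)⟩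
  have h1 : coord F i = coord F j₀ * (coord F i / coord F j₀) := by field_simp
  rw [h1]
  exact mul_mem hx (hM ⟨_, coord_div_mem F i j₀⟩)

/-- The ideal of the relations between the coordinates of the Gauss map is generated by an
irreducible form. -/
theorem exists_irreducible_ker_gaussCoord {d : ℕ} (hd : F.IsHomogeneous d) (hd2 : 2 ≤ d)
    [Algebra.IsAlgebraic (IntermediateField.adjoin K (Set.range (gaussCoord F))) (ConeField F)] :
    ∃ G : MvPolynomial (Fin (n + 1)) K, Irreducible G ∧ (∃ e, G.IsHomogeneous e) ∧
      RingHom.ker (aeval (gaussCoord F) : MvPolynomial (Fin (n + 1)) K →ₐ[K] ConeField F) =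
        Ideal.span {G} := by
  obtain ⟨G, hG, hker⟩ := exists_irreducible_ker_aeval_eq_span (trdeg_coneField F) (gaussCoord F)
  refine ⟨G, hG, ⟨G.totalDegree, isHomogeneous_of_dvd_homogeneousComponent fun e => ?_⟩, hker⟩
  have hmem : ∀ H, G ∣ H ↔ F ∣ aeval (fun i => pderiv i F) H := fun H => by
    rw [← Ideal.mem_span_singleton, ← hker, RingHom.mem_ker, ← aeval_coord_eq_zero_iff,
      ← aeval_gaussCoord]
  rw [hmem]
  exact dvd_aeval_homogeneousComponent hd (b := d - 1) (by omega) (fun i => hd.pderiv)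
    ((hmem G).1 dvd_rfl) e

/-- The gradient of the equation of the dual, evaluated at the coordinates of the Gauss map, is
proportional to the powers of the coordinates. -/
theorem gradient_dual_proportional (p r s : ℕ) [Fact p.Prime] [CharP K p] [PerfectRing K p]
    (hs : p ∣ s)
    {U : Fin (n + 1) → functionField F}
    (hU : ∀ i j, gaussCoord F i * (U j : ConeField F) ^ p ^ r =
      gaussCoord F j * (U i : ConeField F) ^ p ^ r)
    (hsep : IsSeparableMap F (fun i => (U i : ConeField F)))
    {j j₀ : Fin (n + 1)} (hj : gaussCoord F j ≠ 0)
    (hUj : (U j : ConeField F) ≠ 0) (hj₀ : coord F j₀ ≠ 0)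
    (hfrob : ∑ i, coord F i ^ (s * p ^ r) * gaussCoord F i = 0)
    {G : MvPolynomial (Fin (n + 1)) K} (hG : Irreducible G) {e : ℕ} (he : G.IsHomogeneous e)
    (hker : aeval (gaussCoord F) G = 0) :
    (∀ i k, aeval (gaussCoord F) (pderiv i G) * coord F k ^ (s * p ^ r) =
      aeval (gaussCoord F) (pderiv k G) * coord F i ^ (s * p ^ r)) ∧
      ∃ i, aeval (gaussCoord F) (pderiv i G) ≠ 0 := by
  have : CharP (ConeField F) p := charP_of_injective_algebraMap (algebraMap K _).injective p
  set L := ConeField F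
  let v : Fin (n + 1) → L := fun i => coord F j₀ / (U j : L) * (U i : L)
  have hSep : Algebra.IsSeparable (IntermediateField.adjoin K (Set.range v)) L :=
    isSeparable_adjoin_range F (φ := fun i => (U i : L)) hsep hj₀ hUj
  have hAlg : Algebra.IsAlgebraic (IntermediateField.adjoin K (Set.range v)) L :=
    Algebra.IsSeparable.isAlgebraic _ _
  let c : L := coord F j₀ ^ p ^ r / gaussCoord F j
  have hc : c ≠ 0 := div_ne_zero (pow_ne_zero _ hj₀) hj
  have hvc : (fun i => v i ^ p ^ r) = fun i => c * gaussCoord F i := by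
    ext i
    have h1 := hU i j
    have h2 : (U j : L) ^ p ^ r ≠ 0 := pow_ne_zero _ hUj
    simp only [v, c, mul_pow, div_pow]
    rw [div_mul_eq_mul_div, div_mul_eq_mul_div, div_eq_div_iff h2 hj]
    linear_combination -(coord F j₀ ^ p ^ r) * h1
  -- Taking `p^r`-th roots of the coefficients of `G` gives `H(v) ^ p^r = c ^ e G(F_0, …, F_n)`.
  let H : MvPolynomial (Fin (n + 1)) K := map ((iterateFrobeniusEquiv K p r).symm : K →+* K) G
  have hHG : map (iterateFrobenius K p r) H = G := by
    have : (iterateFrobenius K p r).comp ((iterateFrobeniusEquiv K p r).symm : K →+* K) =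
        RingHom.id K := by
      ext x
      exact (iterateFrobeniusEquiv K p r).apply_symm_apply x
    rw [map_map, this, map_id]
  have hHirr : Irreducible H :=
    (MulEquiv.irreducible_iff (mapEquiv (Fin (n + 1)) (iterateFrobeniusEquiv K p r).symm)).2 hG
  have hpow : ∀ (P : MvPolynomial (Fin (n + 1)) K) (m : ℕ),
      (map (iterateFrobenius K p r) P).IsHomogeneous m →
      aeval v P ^ p ^ r = c ^ m * aeval (gaussCoord F) (map (iterateFrobenius K p r) P) := by
    intro P m hP
    rw [← aeval_pow_char, hvc, aeval_mul_of_isHomogeneous hP]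
  have hvH : aeval v H = 0 := by
    have h1 := hpow H e (by rwa [hHG])
    rw [hHG, hker, mul_zero] at h1
    exact eq_zero_of_pow_eq_zero h1
  have hkerH := ker_aeval_eq_span (trdeg_coneField F) v hHirr hvH
  have hsum : ∑ i, coord F i ^ s * v i = 0 := by
    have h1 : (∑ i, coord F i ^ s * v i) ^ p ^ r = 0 := by
      rw [sum_pow_char_pow]
      have h2 : ∀ i, (coord F i ^ s * v i) ^ p ^ r =
          c * (coord F i ^ (s * p ^ r) * gaussCoord F i) := by
        intro i
        rw [mul_pow, ← pow_mul, congrFun hvc i]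
        ring
      simp only [h2]
      rw [← Finset.mul_sum, hfrob, mul_zero]
    exact eq_zero_of_pow_eq_zero h1
  have hs0 : (s : L) = 0 := (CharP.cast_eq_zero_iff L p s).2 hs
  -- As `p ∣ s`, differentiating `hsum` touches only the factors `v i`.
  obtain ⟨h1, i, hi⟩ := gradient_proportional v hkerH (fun i => coord F i ^ s)
    ⟨j₀, pow_ne_zero _ hj₀⟩ (fun D => by
      have h2 := congrArg D hsum
      rw [map_sum, map_zero] at h2
      rw [← h2]
      refine Finset.sum_congr rfl fun i _ => ?_
      rw [D.leibniz (coord F i ^ s) (v i), D.leibniz_pow, ← Nat.cast_smul_eq_nsmul L s, hs0, zero_smul, smul_zero, add_zero,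
        smul_eq_mul])
  have hder : ∀ i, aeval v (pderiv i H) ^ p ^ r =
      c ^ (e - 1) * aeval (gaussCoord F) (pderiv i G) := by
    intro i
    have h3 := hpow (pderiv i H) (e - 1) (by rw [← pderiv_map, hHG]; exact he.pderiv)
    rwa [← pderiv_map, hHG] at h3
  constructor
  · intro i k
    have h3 := congrArg (· ^ p ^ r) (h1 i k)
    simp only [mul_pow, hder, ← pow_mul] at h3
    apply mul_left_cancel₀ (pow_ne_zero (e - 1) hc)
    linear_combination h3
  · refine ⟨i, fun h0 => hi ?_⟩
    have h3 := hder i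
    rw [h0, mul_zero] at h3
    exact eq_zero_of_pow_eq_zero h3

end Gauss

/-! ### From identities in function fields to points, and back. -/

section Points

theorem exists_rep_mk_eq (a : Fin (n + 1) → K) (ha : a ≠ 0) :
    ∃ c : K, c ≠ 0 ∧ (Projectivization.mk K a ha).rep = fun i => c * a i := by
  obtain ⟨c, hc⟩ := Projectivization.exists_smul_eq_mk_rep K a ha
  exact ⟨c, c.ne_zero, by rw [← hc]; rfl⟩

theorem eval_rep_mk_eq_zero_iff {H : MvPolynomial (Fin (n + 1)) K} {e : ℕ} (hH : H.IsHomogeneous e)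
    (a : Fin (n + 1) → K) (ha : a ≠ 0) :
    eval (Projectivization.mk K a ha).rep H = 0 ↔ eval a H = 0 := by
  obtain ⟨c, hc, h⟩ := exists_rep_mk_eq a ha
  rw [h, eval_mul_of_isHomogeneous hH, mul_eq_zero, or_iff_right (pow_ne_zero _ hc)]

theorem subset_zariskiClosure (Z : Set (ProjSpace n K)) : Z ⊆ zariskiClosure Z :=
  fun P hP _ _ _ h => h P hP

theorem eval_aeval (a : Fin (n + 1) → K) (g : Fin (n + 1) → MvPolynomial (Fin (n + 1)) K)
    (H : MvPolynomial (Fin (n + 1)) K) :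
    eval a (aeval g H) = eval (fun i => eval a (g i)) H := by
  have h := comp_aeval_apply g (aeval a : MvPolynomial (Fin (n + 1)) K →ₐ[K] K) H
  simpa [aeval_eq_eval] using h

theorem eval_eq_zero_of_dvd {F H : MvPolynomial (Fin (n + 1)) K} (h : F ∣ H)
    {a : Fin (n + 1) → K} (ha : eval a F = 0) : eval a H = 0 := by
  obtain ⟨Q, rfl⟩ := h
  rw [map_mul, ha, zero_mul]

variable {F : MvPolynomial (Fin (n + 1)) K} [Fact (Irreducible F)]

theorem dvd_of_forall_mem_zeroLocus [IsAlgClosed K] {j : Fin (n + 1)} (hj : coord F j ≠ 0) {d : ℕ}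
    (hd : F.IsHomogeneous d) {H : MvPolynomial (Fin (n + 1)) K} {e : ℕ} (hH : H.IsHomogeneous e)
    (h : ∀ P ∈ zeroLocus F, eval P.rep H = 0) : F ∣ H :=
  dvd_of_forall_ne_zero_eval hj fun a ha haF =>
    (eval_rep_mk_eq_zero_iff hH a ha).1 (h _ ((eval_rep_mk_eq_zero_iff hd a ha).2 haF))

theorem sum_coord_pow_mul_gaussCoord [IsAlgClosed K] {j : Fin (n + 1)} (hj : coord F j ≠ 0) {d : ℕ}
    (hd : F.IsHomogeneous d) {q : ℕ} (h : IsFrobeniusNonclassical F q) :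
    ∑ i, coord F i ^ q * gaussCoord F i = 0 := by
  have hdvd : F ∣ ∑ i, X i ^ q * pderiv i F := by
    refine dvd_of_forall_mem_zeroLocus hj hd (e := q + (d - 1))
      (IsHomogeneous.sum _ _ _ fun i _ => (isHomogeneous_X_pow i q).mul hd.pderiv) fun P hP => ?_
    by_cases hreg : (fun i => eval P.rep (pderiv i F)) = 0
    -- At singular points the form vanishes trivially, so it vanishes on the whole hypersurface.
    · simp [fun i => congrFun hreg i]
    have h1 : P ∈ frobeniusNonclassicalLocus F q := by
      rw [show frobeniusNonclassicalLocus F q = regularLocus F from h]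
      exact ⟨hP, hreg⟩
    have h2 : ∑ i, eval P.rep (pderiv i F) * (frobeniusMap q P).rep i = 0 := h1.2
    obtain ⟨c, hc, h3⟩ := exists_rep_mk_eq (fun i => P.rep i ^ q) (by
      intro h0
      apply P.rep_nonzero
      funext i
      exact eq_zero_of_pow_eq_zero (congrFun h0 i))
    rw [frobeniusMap, h3] at h2
    apply (mul_eq_zero.1 _).resolve_left hc
    rw [← h2, map_sum, Finset.mul_sum]
    refine Finset.sum_congr rfl fun i _ => ?_
    simp only [map_mul, map_pow, eval_X]
    ring
  rw [← aeval_coord_eq_zero_iff] at hdvd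
  simpa [gaussCoord_eq] using hdvd

theorem dvd_aeval_pderiv_iff {H : MvPolynomial (Fin (n + 1)) K} :
    F ∣ aeval (fun i => pderiv i F) H ↔ aeval (gaussCoord F) H = 0 := by
  rw [aeval_gaussCoord, aeval_coord_eq_zero_iff]

omit [Fact (Irreducible F)] in
theorem eval_rep_gaussMap_eq_zero_iff {P : ProjSpace n K} (hP : P ∈ regularLocus F)
    {H : MvPolynomial (Fin (n + 1)) K} {e : ℕ} (hH : H.IsHomogeneous e) :
    eval (gaussMap F P hP).rep H = 0 ↔ eval P.rep (aeval (fun i => pderiv i F) H) = 0 := by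
  rw [gaussMap, eval_rep_mk_eq_zero_iff hH, eval_aeval]

theorem eval_rep_gaussMap_of_mem_ker {P : ProjSpace n K} (hP : P ∈ regularLocus F)
    {H : MvPolynomial (Fin (n + 1)) K} {e : ℕ} (hH : H.IsHomogeneous e)
    (h : aeval (gaussCoord F) H = 0) : eval (gaussMap F P hP).rep H = 0 :=
  (eval_rep_gaussMap_eq_zero_iff hP hH).2
    (eval_eq_zero_of_dvd (dvd_aeval_pderiv_iff.2 h) hP.1)

/-- A form that vanishes on the image of the Gauss map is a relation between its coordinates. -/
theorem aeval_gaussCoord_eq_zero [IsAlgClosed K] {j j₀ : Fin (n + 1)} (hj₀ : coord F j₀ ≠ 0)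
    (hj : gaussCoord F j ≠ 0) {d : ℕ} (hd : F.IsHomogeneous d)
    {H : MvPolynomial (Fin (n + 1)) K} {e : ℕ} (hH : H.IsHomogeneous e)
    (h : ∀ (P : ProjSpace n K) (hP : P ∈ regularLocus F), eval (gaussMap F P hP).rep H = 0) :
    aeval (gaussCoord F) H = 0 := by
  rw [← dvd_aeval_pderiv_iff]
  -- The extra factor vanishes at the singular points, where the Gauss map is undefined; `F` does
  -- not divide it.
  have h1 : F ∣ aeval (fun i => pderiv i F) H * pderiv j F := by
    refine dvd_of_forall_mem_zeroLocus hj₀ hd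
      ((hH.aeval _ (fun i => hd.pderiv)).mul hd.pderiv) fun P hP => ?_
    rw [map_mul]
    by_cases h0 : eval P.rep (pderiv j F) = 0
    · rw [h0, mul_zero]
    · have hreg : P ∈ regularLocus F := ⟨hP, fun hz => h0 (congrFun hz j)⟩
      rw [(eval_rep_gaussMap_eq_zero_iff hreg hH).1 (h P hreg), zero_mul]
  exact ((Fact.out : Irreducible F).prime.dvd_or_dvd h1).resolve_right
    fun h2 => hj ((residue_eq_zero_iff F).2 h2)

theorem strictDual_eq_zeroLocus [IsAlgClosed K] {j j₀ : Fin (n + 1)} (hj₀ : coord F j₀ ≠ 0)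
    (hj : gaussCoord F j ≠ 0) {d : ℕ} (hd : F.IsHomogeneous d)
    {G : MvPolynomial (Fin (n + 1)) K} {e : ℕ} (hG : G.IsHomogeneous e)
    (hker : RingHom.ker (aeval (gaussCoord F) : MvPolynomial (Fin (n + 1)) K →ₐ[K] ConeField F) =
      Ideal.span {G}) : strictDual F = zeroLocus G := by
  have hmem : ∀ H, aeval (gaussCoord F) H = 0 ↔ G ∣ H := fun H => by
    rw [← Ideal.mem_span_singleton, ← hker, RingHom.mem_ker]
  ext Q
  constructor
  · intro hQ
    refine hQ G e hG ?_
    rintro _ ⟨P, hP, rfl⟩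
    exact eval_rep_gaussMap_of_mem_ker hP hG ((hmem G).2 dvd_rfl)
  · intro hQ H m hH hvan
    refine eval_eq_zero_of_dvd ((hmem H).1 ?_) hQ
    exact aeval_gaussCoord_eq_zero hj₀ hj hd hH fun P hP => hvan _ ⟨P, hP, rfl⟩

/-- Any equation of the dual is a relation between the Gauss coordinates, hence associated to `G`.
-/
theorem ker_eq_span_of_isEquationOf [IsAlgClosed K] {j j₀ : Fin (n + 1)} (hj₀ : coord F j₀ ≠ 0)
    (hj : gaussCoord F j ≠ 0) {d : ℕ} (hd : F.IsHomogeneous d)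
    {G : MvPolynomial (Fin (n + 1)) K} (hG : Irreducible G)
    (hker : RingHom.ker (aeval (gaussCoord F) : MvPolynomial (Fin (n + 1)) K →ₐ[K] ConeField F) =
      Ideal.span {G}) {G' : MvPolynomial (Fin (n + 1)) K} (hG' : IsEquationOf G' (strictDual F)) :
    RingHom.ker (aeval (gaussCoord F) : MvPolynomial (Fin (n + 1)) K →ₐ[K] ConeField F) =
      Ideal.span {G'} := by
  obtain ⟨e, he⟩ := hG'.homogeneous
  have h1 : aeval (gaussCoord F) G' = 0 :=
    aeval_gaussCoord_eq_zero hj₀ hj hd he fun P hP => by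
      have h2 : gaussMap F P hP ∈ zeroLocus G' := by
        rw [hG'.zeroLocus_eq]
        exact subset_zariskiClosure _ ⟨P, hP, rfl⟩
      exact h2
  have h3 : G ∣ G' := by rwa [← Ideal.mem_span_singleton, ← hker, RingHom.mem_ker]
  rw [hker]
  exact Ideal.span_singleton_eq_span_singleton.2 (hG.associated_of_dvd hG'.irreducible h3)

/-- A form that vanishes at the points of `F = 0` at which the composition of the two Gauss maps is
defined is divisible by `F`. -/
theorem dvd_of_forall_gaussMap_mem [IsAlgClosed K] {j j₀ i₀ : Fin (n + 1)} (hj₀ : coord F j₀ ≠ 0)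
    (hj : gaussCoord F j ≠ 0) {d : ℕ} (hd : F.IsHomogeneous d)
    {G : MvPolynomial (Fin (n + 1)) K} {e : ℕ} (he : G.IsHomogeneous e)
    (hG0 : aeval (gaussCoord F) G = 0) (hi₀ : aeval (gaussCoord F) (pderiv i₀ G) ≠ 0)
    {H : MvPolynomial (Fin (n + 1)) K} {m : ℕ} (hH : H.IsHomogeneous m)
    (h : ∀ (P : ProjSpace n K) (hP : P ∈ regularLocus F), gaussMap F P hP ∈ regularLocus G →
      eval P.rep H = 0) : F ∣ H := by
  have hprime := (Fact.out : Irreducible F).prime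
  have h1 : F ∣ H * (pderiv j F * aeval (fun i => pderiv i F) (pderiv i₀ G)) := by
    refine dvd_of_forall_mem_zeroLocus hj₀ hd
      (hH.mul (hd.pderiv.mul (he.pderiv.aeval _ (fun i => hd.pderiv)))) fun P hP => ?_
    rw [map_mul, map_mul]
    by_cases h0 : eval P.rep (pderiv j F) = 0
    · rw [h0, zero_mul, mul_zero]
    by_cases h2 : eval P.rep (aeval (fun i => pderiv i F) (pderiv i₀ G)) = 0
    · rw [h2, mul_zero, mul_zero]
    have hreg : P ∈ regularLocus F := ⟨hP, fun hz => h0 (congrFun hz j)⟩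
    rw [h P hreg ⟨eval_rep_gaussMap_of_mem_ker hreg he hG0, fun hz =>
      h2 ((eval_rep_gaussMap_eq_zero_iff hreg he.pderiv).1 (congrFun hz i₀))⟩, zero_mul]
  refine (hprime.dvd_or_dvd h1).resolve_right fun h2 => ?_
  rcases hprime.dvd_or_dvd h2 with h3 | h3
  · exact hj ((residue_eq_zero_iff F).2 h3)
  · exact hi₀ (dvd_aeval_pderiv_iff.1 h3)

theorem zariskiClosure_gaussMap_mem [IsAlgClosed K] {j j₀ i₀ : Fin (n + 1)}
    (hj₀ : coord F j₀ ≠ 0) (hj : gaussCoord F j ≠ 0) {d : ℕ} (hd : F.IsHomogeneous d)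
    {G : MvPolynomial (Fin (n + 1)) K} {e : ℕ} (he : G.IsHomogeneous e)
    (hG0 : aeval (gaussCoord F) G = 0) (hi₀ : aeval (gaussCoord F) (pderiv i₀ G) ≠ 0) :
    zariskiClosure {P | ∃ hP : P ∈ regularLocus F, gaussMap F P hP ∈ regularLocus G} =
      zeroLocus F := by
  ext P
  constructor
  · intro hP
    exact hP F d hd fun Q hQ => hQ.1.1
  · intro hP H m hH hvan
    exact eval_eq_zero_of_dvd (dvd_of_forall_gaussMap_mem hj₀ hj hd he hG0 hi₀ hH
      fun Q hQ hQG => hvan Q ⟨hQ, hQG⟩) hP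

theorem gaussMap_gaussMap {q : ℕ} {G : MvPolynomial (Fin (n + 1)) K} {e : ℕ}
    (he : G.IsHomogeneous e)
    (hrel : ∀ i k, aeval (gaussCoord F) (pderiv i G) * coord F k ^ q =
      aeval (gaussCoord F) (pderiv k G) * coord F i ^ q)
    (P : ProjSpace n K) (hP : P ∈ regularLocus F) (hQ : gaussMap F P hP ∈ regularLocus G) :
    gaussMap G (gaussMap F P hP) hQ = frobeniusMap q P := by
  obtain ⟨c, hc, hrep⟩ := exists_rep_mk_eq (fun i => eval P.rep (pderiv i F)) hP.2
  obtain ⟨k, hk⟩ : ∃ k, P.rep k ≠ 0 := by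
    by_contra! h0
    exact P.rep_nonzero (funext h0)
  have hpt : ∀ i, eval (fun l => eval P.rep (pderiv l F)) (pderiv i G) * P.rep k ^ q =
      eval (fun l => eval P.rep (pderiv l F)) (pderiv k G) * P.rep i ^ q := by
    intro i
    have h1 : F ∣ aeval (fun l => pderiv l F) (pderiv i G) * X k ^ q -
        aeval (fun l => pderiv l F) (pderiv k G) * X i ^ q := by
      rw [← aeval_coord_eq_zero_iff]
      simp only [map_sub, map_mul, map_pow, aeval_X, ← aeval_gaussCoord]
      rw [hrel i k, sub_self]
    have h2 := eval_eq_zero_of_dvd h1 hP.1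
    simp only [map_sub, map_mul, map_pow, eval_X, eval_aeval] at h2
    exact sub_eq_zero.1 h2
  rw [gaussMap, frobeniusMap, Projectivization.mk_eq_mk_iff']
  -- The factor `c ^ (e - 1)` comes from the chosen representative of the Gauss image, the partial
  -- derivatives of `G` having degree `e - 1`.
  refine ⟨c ^ (e - 1) * (eval (fun l => eval P.rep (pderiv l F)) (pderiv k G) / P.rep k ^ q), ?_⟩
  funext i
  rw [gaussMap, hrep, eval_mul_of_isHomogeneous he.pderiv, Pi.smul_apply, smul_eq_mul, mul_assoc,
    div_mul_eq_mul_div, ← hpt i, mul_div_cancel_right₀ _ (pow_ne_zero _ hk)]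

/-- One inclusion is `F(x ^ q) = F(x) ^ q = 0` carried through the proportionality `hrel`. For the
other, a form vanishing on the image of the second Gauss map vanishes on `Φ_q` of a dense set, hence
on `Φ_q` of the hypersurface, which is the hypersurface since `q`-th roots of its points lie on it.
-/
theorem strictDual_strictDual_eq [IsAlgClosed K] {q : ℕ} (hq : 0 < q) {j j₀ i₀ : Fin (n + 1)}
    (hj₀ : coord F j₀ ≠ 0) (hj : gaussCoord F j ≠ 0) {d : ℕ} (hd : F.IsHomogeneous d)
    (hFK : ∀ a : Fin (n + 1) → K, eval (fun i => a i ^ q) F = eval a F ^ q)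
    (hFL : aeval (fun i => coord F i ^ q) F = aeval (coord F) F ^ q)
    {G : MvPolynomial (Fin (n + 1)) K} {e : ℕ} (he : G.IsHomogeneous e)
    (hker : RingHom.ker (aeval (gaussCoord F) : MvPolynomial (Fin (n + 1)) K →ₐ[K] ConeField F) =
      Ideal.span {G})
    (hrel : ∀ i k, aeval (gaussCoord F) (pderiv i G) * coord F k ^ q =
      aeval (gaussCoord F) (pderiv k G) * coord F i ^ q)
    (hi₀ : aeval (gaussCoord F) (pderiv i₀ G) ≠ 0) :
    strictDual G = zeroLocus F := by
  have hmem : ∀ H, aeval (gaussCoord F) H = 0 ↔ G ∣ H := fun H => by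
    rw [← Ideal.mem_span_singleton, ← hker, RingHom.mem_ker]
  have hG0 : aeval (gaussCoord F) G = 0 := (hmem G).2 dvd_rfl
  ext P
  constructor
  · intro hP
    refine hP F d hd ?_
    rintro _ ⟨Q, hQ, rfl⟩
    rw [eval_rep_gaussMap_eq_zero_iff hQ hd]
    refine eval_eq_zero_of_dvd ((hmem _).1 ?_) hQ.1
    rw [comp_aeval_apply]
    have h1 : (fun i => aeval (gaussCoord F) (pderiv i G)) = fun i =>
        (aeval (gaussCoord F) (pderiv j₀ G) / coord F j₀ ^ q) * coord F i ^ q := by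
      funext i
      rw [div_mul_eq_mul_div, ← hrel i j₀, mul_div_cancel_right₀ _ (pow_ne_zero _ hj₀)]
    rw [h1, aeval_mul_of_isHomogeneous hd, hFL, (aeval_coord_eq_zero_iff F).2 dvd_rfl,
      zero_pow hq.ne', mul_zero]
  · intro hP H m hH hvan
    have h1 : F ∣ aeval (fun i => X i ^ q) H := by
      refine dvd_of_forall_gaussMap_mem hj₀ hj hd he hG0 hi₀
        (hH.aeval _ (fun i => isHomogeneous_X_pow i q)) fun Q hQ hQG => ?_
      have h2 := hvan (frobeniusMap q Q)
        ⟨gaussMap F Q hQ, hQG, gaussMap_gaussMap he hrel Q hQ hQG⟩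
      rw [frobeniusMap, eval_rep_mk_eq_zero_iff hH] at h2
      rw [eval_aeval]
      simpa using h2
    choose a ha using fun i => IsAlgClosed.exists_pow_nat_eq (P.rep i) hq
    have ha' : (fun i => a i ^ q) = P.rep := funext ha
    have h3 : eval a F = 0 := by
      have h4 := hFK a
      rw [ha', show eval P.rep F = 0 from hP] at h4
      exact eq_zero_of_pow_eq_zero h4.symm
    have h5 := eval_eq_zero_of_dvd h1 h3
    rw [eval_aeval] at h5
    simpa [ha'] using h5

/-- If the gradient of the equation of the dual gives back the powers of the coordinates, then the
Gauss map is purely inseparable. -/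
theorem isPurelyInseparableMap_gaussCoord (p f : ℕ) [Fact p.Prime] [CharP K p]
    (hx : ∀ i, coord F i ≠ 0) {j i₀ : Fin (n + 1)} (hj : gaussCoord F j ≠ 0) {d : ℕ}
    (hd : F.IsHomogeneous d) {G : MvPolynomial (Fin (n + 1)) K} {e : ℕ} (he : G.IsHomogeneous e)
    (hrel : ∀ i k, aeval (gaussCoord F) (pderiv i G) * coord F k ^ p ^ f =
      aeval (gaussCoord F) (pderiv k G) * coord F i ^ p ^ f)
    (hi₀ : aeval (gaussCoord F) (pderiv i₀ G) ≠ 0) :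
    IsPurelyInseparableMap F (gaussCoord F) := by
  set N := fieldOfMap F (gaussCoord F) with hN
  have hcharM : CharP (functionField F) p :=
    charP_of_injective_algebraMap (algebraMap K (functionField F)).injective p
  have hcharN : CharP N p := charP_of_injective_algebraMap (algebraMap K N).injective p
  choose m hm using fun i => exists_aeval_coord_eq F (hx j) (hd.pderiv (i := i))
  simp only [← gaussCoord_eq] at hm
  let w : Fin (n + 1) → functionField F := fun i => m i / m j
  have hw : ∀ i, (w i : ConeField F) = gaussCoord F i / gaussCoord F j := by
    intro i
    rw [hm i, hm j, mul_div_mul_left _ _ (pow_ne_zero _ (hx j))]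
    rfl
  have hwN : ∀ i, w i ∈ N := fun i => IntermediateField.subset_adjoin _ _ ⟨i, j, hw i⟩
  have haevN : ∀ H : MvPolynomial (Fin (n + 1)) K, aeval w H ∈ N := by
    intro H
    have : aeval w H = ((aeval (fun i => (⟨w i, hwN i⟩ : N)) H : N) : functionField F) := by
      rw [← IntermediateField.coe_val, comp_aeval_apply]
      rfl
    rw [this]
    exact SetLike.coe_mem _
  have haev : ∀ i, aeval (gaussCoord F) (pderiv i G) =
      gaussCoord F j ^ (e - 1) * ((aeval w (pderiv i G) : functionField F) : ConeField F) := by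
    intro i
    have h1 : gaussCoord F = fun i => gaussCoord F j * (w i : ConeField F) := by
      funext i
      rw [hw, mul_div_cancel₀ _ hj]
    conv_lhs => rw [h1]
    rw [aeval_mul_of_isHomogeneous he.pderiv, ← IntermediateField.coe_val, comp_aeval_apply]
  have hne : ∀ k, aeval (gaussCoord F) (pderiv k G) ≠ 0 := by
    intro k h0
    have h1 := hrel i₀ k
    rw [h0, zero_mul] at h1
    exact mul_ne_zero hi₀ (pow_ne_zero _ (hx k)) h1
  -- Raising to the power `p ^ f` is a field homomorphism, so only the generators `x_i / x_k`
  -- matter.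
  have hpow : ∀ (z : ConeField F) (hz : z ∈ functionField F),
      (⟨z, hz⟩ : functionField F) ^ p ^ f ∈ N := by
    intro z hz
    induction hz using IntermediateField.adjoin_induction with
    | mem z hz =>
      obtain ⟨i, k, rfl⟩ := hz
      have h1 : (⟨coord F i / coord F k, coord_div_mem F i k⟩ : functionField F) ^ p ^ f =
          aeval w (pderiv i G) / aeval w (pderiv k G) := by
        apply Subtype.ext
        change (coord F i / coord F k) ^ p ^ f =
          ((aeval w (pderiv i G) : functionField F) : ConeField F) /
            ((aeval w (pderiv k G) : functionField F) : ConeField F)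
        refine Eq.trans ?_ (mul_div_mul_left _ _ (pow_ne_zero (e - 1) hj))
        rw [← haev, ← haev, div_pow, div_eq_div_iff (pow_ne_zero _ (hx k)) (hne k)]
        linear_combination -hrel i k
      have h2 := N.div_mem (haevN (pderiv i G)) (haevN (pderiv k G))
      rw [← h1] at h2
      exact h2
    | algebraMap c =>
      have h1 : (algebraMap K (functionField F) c) ^ p ^ f ∈ N :=
        pow_mem (N.algebraMap_mem c) _
      exact h1
    | add a b ha hb iha ihb =>
      have h1 : (⟨a + b, add_mem ha hb⟩ : functionField F) ^ p ^ f =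
          ⟨a, ha⟩ ^ p ^ f + ⟨b, hb⟩ ^ p ^ f := by
        rw [← add_pow_char_pow]; rfl
      rw [h1]
      exact add_mem iha ihb
    | inv a ha iha =>
      have h1 : (⟨a⁻¹, inv_mem ha⟩ : functionField F) ^ p ^ f = (⟨a, ha⟩ ^ p ^ f)⁻¹ := by
        rw [← inv_pow]; rfl
      rw [h1]
      exact inv_mem iha
    | mul a b ha hb iha ihb =>
      have h1 : (⟨a * b, mul_mem ha hb⟩ : functionField F) ^ p ^ f =
          ⟨a, ha⟩ ^ p ^ f * ⟨b, hb⟩ ^ p ^ f := by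
        rw [← mul_pow]; rfl
      rw [h1]
      exact mul_mem iha ihb
  exact (isPurelyInseparable_iff_pow_mem N p).2 fun z => ⟨f, ⟨⟨_, hpow z.1 z.2⟩, rfl⟩⟩

end Points

end FrobNonclassical

end

/-! ### The main theorem. -/

open FrobNonclassical in
theorem mainTheorem4 {k K : Type*} [Field k] [Fintype k] [Field K] [Algebra k K]
    [IsAlgClosure k K] (p : ℕ) [Fact p.Prime] [CharP k p] (q : ℕ) (hq : Fintype.card k = q)
    (n : ℕ) (hn : 2 ≤ n) (F₀ : MvPolynomial (Fin (n + 1)) k) (d : ℕ)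
    (hhom : F₀.IsHomogeneous d) (F : MvPolynomial (Fin (n + 1)) K)
    (hF : F = MvPolynomial.map (algebraMap k K) F₀) [Fact (Irreducible F)]
    (hnondeg : IsNondegenerate (zeroLocus F))
    (hfrob : IsFrobeniusNonclassical F q)
    (r : ℕ) (hA : PropertyA F p r) (hr : p ^ r < q) :
    -- the Gauss map is purely inseparable
    IsPurelyInseparableMap F (gaussCoord F) ∧
    -- the strict dual is an irreducible hypersurface
    (∃ G : MvPolynomial (Fin (n + 1)) K, IsEquationOf G (strictDual F)) ∧
    -- and, for every equation `G` of the strict dual,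
    ∀ G : MvPolynomial (Fin (n + 1)) K, IsEquationOf G (strictDual F) →
      -- the strict dual of the strict dual is the given hypersurface,
      strictDual G = zeroLocus F ∧
      -- the composition of the two Gauss maps is defined on a dense set of points,
      zariskiClosure {P | ∃ hP : P ∈ regularLocus F, gaussMap F P hP ∈ regularLocus G} =
        zeroLocus F ∧
      -- and it is the Frobenius map wherever it is defined
      ∀ (P : ProjSpace n K) (hP : P ∈ regularLocus F) (hQ : gaussMap F P hP ∈ regularLocus G),
        gaussMap G (gaussMap F P hP) hQ = frobeniusMap q P := by
  have hAC : IsAlgClosed K := IsAlgClosure.isAlgClosed k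
  have hCK : CharP K p := charP_of_injective_algebraMap (algebraMap k K).injective p
  have hCL : CharP (ConeField F) p :=
    charP_of_injective_algebraMap (algebraMap K (ConeField F)).injective p
  have hp : p.Prime := Fact.out
  obtain ⟨f, -, hf⟩ := FiniteField.card k p
  have hqf : q = p ^ (f : ℕ) := hq.symm.trans hf
  have hrf : r < (f : ℕ) := (Nat.pow_lt_pow_iff_right hp.one_lt).1 (hqf ▸ hr)
  have hqs : p ^ ((f : ℕ) - r) * p ^ r = q := by
    rw [← pow_add, Nat.sub_add_cancel hrf.le, hqf]
  have hd : F.IsHomogeneous d := hF ▸ hhom.map _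
  have hd2 : 2 ≤ d := two_le_of_isHomogeneous hnondeg hd
  have hx : ∀ i, coord F i ≠ 0 := coord_ne_zero hnondeg
  -- The coefficients of `F` lie in the field with `q = p ^ f` elements.
  have hfix : map (iterateFrobenius K p f) F = F := by
    have h1 : (iterateFrobenius K p f).comp (algebraMap k K) = algebraMap k K := by
      ext a
      rw [RingHom.comp_apply, iterateFrobenius_def, ← map_pow, ← hf, FiniteField.pow_card]
    rw [hF, map_map, h1]
  have hFK : ∀ a : Fin (n + 1) → K, eval (fun i => a i ^ q) F = eval a F ^ q := by
    intro a
    have h1 := aeval_pow_char p f a F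
    rw [hfix] at h1
    simpa [aeval_eq_eval, hqf] using h1
  have hFL : aeval (fun i => coord F i ^ q) F = aeval (coord F) F ^ q := by
    have h1 := aeval_pow_char p f (coord F) F
    rwa [hfix, ← hqf] at h1
  have hq0 : 0 < q := hqf ▸ pow_pos hp.pos _
  obtain ⟨-, U, hU0, hU, hfin, hsep⟩ := hA
  obtain ⟨j, hj⟩ := exists_gaussCoord_ne_zero F p hd hd2
  have hUj : (U j : ConeField F) ≠ 0 := by
    intro h0
    apply hU0
    funext i
    have h1 := hU i j
    rw [h0, zero_pow (pow_ne_zero _ hp.ne_zero), mul_zero] at h1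
    exact Subtype.ext (eq_zero_of_pow_eq_zero ((mul_eq_zero.1 h1.symm).resolve_left hj))
  have hAlg := isAlgebraic_adjoin_gaussCoord (pow_ne_zero r hp.ne_zero) hU hfin hd hd2 hj (hx 0)
  obtain ⟨G, hG, ⟨e, he⟩, hker⟩ := exists_irreducible_ker_gaussCoord hd hd2
  have hzero : ∀ H, RingHom.ker (aeval (gaussCoord F) :
      MvPolynomial (Fin (n + 1)) K →ₐ[K] ConeField F) = Ideal.span {H} →
      aeval (gaussCoord F) H = 0 := fun H hH => by
    rw [← RingHom.mem_ker, hH]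
    exact Ideal.mem_span_singleton_self H
  have hsum := sum_coord_pow_mul_gaussCoord (hx 0) hd hfrob
  have hrel : ∀ H : MvPolynomial (Fin (n + 1)) K, Irreducible H → ∀ m, H.IsHomogeneous m →
      aeval (gaussCoord F) H = 0 →
      (∀ i l, aeval (gaussCoord F) (pderiv i H) * coord F l ^ q =
        aeval (gaussCoord F) (pderiv l H) * coord F i ^ q) ∧
        ∃ i, aeval (gaussCoord F) (pderiv i H) ≠ 0 := by
    intro H hH m hm hH0
    -- Here `s = q / p^r = p ^ (f - r)` is divisible by `p` precisely because `p^r < q`.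
    have h1 := gradient_dual_proportional p r (p ^ ((f : ℕ) - r))
      (dvd_pow_self p (by omega)) hU hsep hj hUj (hx 0) (by rwa [hqs]) hH hm hH0
    rwa [hqs] at h1
  refine ⟨?_, ⟨G, ⟨e, he⟩, hG, (strictDual_eq_zeroLocus (hx 0) hj hd he hker).symm⟩, ?_⟩
  · obtain ⟨h1, i₀, hi₀⟩ := hrel G hG e he (hzero G hker)
    rw [hqf] at h1
    exact isPurelyInseparableMap_gaussCoord p f hx hj hd he h1 hi₀
  · intro G' hG'
    have hker' := ker_eq_span_of_isEquationOf (hx 0) hj hd hG hker hG'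
    obtain ⟨m, hm⟩ := hG'.homogeneous
    obtain ⟨h1, i₀, hi₀⟩ := hrel G' hG'.irreducible m hm (hzero G' hker')
    exact ⟨strictDual_strictDual_eq hq0 (hx 0) hj hd hFK hFL hm hker' h1 hi₀,
      zariskiClosure_gaussMap_mem (hx 0) hj hd hm (hzero G' hker') hi₀,
      gaussMap_gaussMap hm h1⟩
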